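/- Let $r\ge 3$. For $t\ge 0$ let $\mathcal P^r_t$ be the $r$-uniform loose path of length $t$: it has vertices $v_1,\dots,v_{t+1}$ and $u_{i,j}$ ($1\le i\le t$, $1\le j\le r-2$), all distinct, and edges $e_i=\{v_i,u_{i,1},\dots,u_{i,r-2},v_{i+1}\}$ for $1\le i\le t$. For positive integers $a,b,c$ let $\mathcal Q(a,b,c)$ be the $r$-uniform hypergraph obtained from $\mathcal P^r_{a+b+c}$ by attaching one pendent edge (a new edge formed by the given vertex and $r-1$ new vertices) at each of the vertices $v_{a+1}$ and $v_{a+b+1}$, and let $\mathcal W_n=\mathcal Q(1,n-4,1)$ for $n\ge 5$. Let $\cup$ denote the disjoint union. For an $r$-uniform hypergraph $\mathcal H$ on a finite vertex set $V$ with $|V|=s$, the adjacency tensor $\mathcal A(\mathcal H)=(a_{i_1\cdots i_r})_{i_1,\dots,i_r\in V}$ has $a_{i_1\cdots i_r}=\frac1{(r-1)!}$ if $\{i_1,\dots,i_r\}$ is an edge and $a_{i_1\cdots i_r}=0$ otherwise. An eigenvalue of $\mathcal A(\mathcal H)$ is a $\lambda\in\mathbb C$ for which there is a nonzero $x\in\mathbb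 C^V$ with $\sum_{i_2,\dots,i_r\in V}a_{i i_2\cdots i_r}x_{i_2}\cdots x_{i_r}=\lambda x_i^{r-1}$ for all $i\in V$, and the spectral radius $\rho(\mathcal H)$ is the maximum modulus of an eigenvalue of $\mathcal A(\mathcal H)$. Let $m(\mathcal H,k)$ be the number of sets of $k$ pairwise disjoint edges of $\mathcal H$. The matching energy $ME(\mathcal H)$ is the sum of the absolute values of the complex roots, counted with multiplicity, of the matching polynomial $\varphi(\mathcal H,x)=\sum_{k\ge 0}(-1)^k m(\mathcal H,k)x^{s-kr}$. **Theorem.** Let $m,n\ge 6$ and $r\ge 3$. The maxima defining the spectral radii of $\mathcal P^r_{m-5}\cup\mathcal W_{n-1}$ and $\mathcal P^r_{n-5}\cup\mathcal W_{m-1}$ exist, and $$\rho(\mathcal P^r_{m-5}\cup\mathcal W_{n-1})=\rho(\mathcal P^r_{n-5}\cup\mathcal W_{m-1})\quad\text{and}\quad ME(\mathcal P^r_{m-5}\cup\mathcal W_{n-1})=ME(\mathcal P^r_{n-5}\cup\mathcal W_{m-1}).$$ -/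

import Mathlib

/-- An `r`-uniform hypergraph on the vertex set `V`: a finite set of edges, every edge being a set
of exactly `r` vertices. -/
structure UniformHypergraph (r : ℕ) (V : Type) where
  /-- the edges -/
  edges : Finset (Finset V)
  /-- every edge has `r` vertices -/
  uniform : ∀ e ∈ edges, e.card = r

/-- A real tensor `(a_{i i₂ … i_r})` of order `r` (for `r ≥ 1`) whose indices range over `V`.
The first index is kept apart from the other `r - 1` ones. -/
abbrev RealTensor (r : ℕ) (V : Type) : Type := V → (Fin (r - 1) → V) → ℝ

namespace RealTensor

/-- The vector `A x`, whose `i`-th component is `∑_{i₂, …, i_r} a_{i i₂ … i_r} x_{i₂} ⋯ x_{i_r}`. -/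
noncomputable def apply {r : ℕ} {V : Type} [Fintype V] (A : RealTensor r V) (x : V → ℂ) (i : V) :
    ℂ :=
  ∑ j : Fin (r - 1) → V, (A i j : ℂ) * ∏ k : Fin (r - 1), x (j k)

/-- `μ` is an eigenvalue of `A`: there is a nonzero complex vector `x` with
`(A x)_i = μ x_i ^ (r - 1)` for all `i`. -/
def IsEigenvalue {r : ℕ} {V : Type} [Fintype V] (A : RealTensor r V) (μ : ℂ) : Prop :=
  ∃ x : V → ℂ, x ≠ 0 ∧ ∀ i : V, A.apply x i = μ * x i ^ (r - 1)

/-- The set of the moduli of the eigenvalues of `A`. -/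
def eigenvalueModuli {r : ℕ} {V : Type} [Fintype V] (A : RealTensor r V) : Set ℝ :=
  {t : ℝ | ∃ μ : ℂ, A.IsEigenvalue μ ∧ ‖μ‖ = t}

end RealTensor

namespace UniformHypergraph

/-- The adjacency tensor: `a_{i₁ … i_r} = 1 / (r - 1)!` if `{i₁, …, i_r}` is an edge, and `0`
otherwise. -/
noncomputable def adjacencyTensor {r : ℕ} {V : Type} [DecidableEq V] (H : UniformHypergraph r V) :
    RealTensor r V :=
  fun i j => if insert i (Finset.univ.image j) ∈ H.edges then 1 / ((r - 1).factorial : ℝ) else 0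

/-- The spectral radius: the largest modulus of an eigenvalue of the adjacency tensor. -/
noncomputable def spectralRadius {r : ℕ} {V : Type} [Fintype V] [DecidableEq V]
    (H : UniformHypergraph r V) : ℝ :=
  sSup H.adjacencyTensor.eigenvalueModuli

/-- The number of `k`-matchings, that is, of sets of `k` pairwise disjoint edges. -/
def matchingCount {r : ℕ} {V : Type} [DecidableEq V] (H : UniformHypergraph r V) (k : ℕ) : ℕ :=
  ((H.edges.powersetCard k).filter
    (fun M => ∀ e ∈ M, ∀ f ∈ M, e ≠ f → Disjoint e f)).card

/-- The matching polynomial `∑_{k ≥ 0} (-1)^k m(H, k) x^{n - k r}`, where `n` is the number of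
vertices. There are no `k`-matchings when `k` exceeds the number of edges or when `n < k r`. -/
noncomputable def matchingPolynomial {r : ℕ} {V : Type} [Fintype V] [DecidableEq V]
    (H : UniformHypergraph r V) : Polynomial ℤ :=
  ∑ k ∈ Finset.range (H.edges.card + 1),
    Polynomial.monomial (Fintype.card V - k * r) ((-1) ^ k * (H.matchingCount k : ℤ))

/-- The matching energy: the sum of the absolute values of the complex roots of the matching
polynomial, counted with multiplicity. -/
noncomputable def matchingEnergy {r : ℕ} {V : Type} [Fintype V] [DecidableEq V]
    (H : UniformHypergraph r V) : ℝ :=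
  ((H.matchingPolynomial.aroots ℂ).map (fun z => ‖z‖)).sum

/-- The disjoint union of two hypergraphs. -/
def disjointUnion {r : ℕ} {V W : Type} [DecidableEq V] [DecidableEq W]
    (G : UniformHypergraph r V) (H : UniformHypergraph r W) : UniformHypergraph r (V ⊕ W) where
  edges := G.edges.image (fun e => e.map Function.Embedding.inl) ∪
    H.edges.image (fun e => e.map Function.Embedding.inr)
  uniform := by
    intro e he
    rcases Finset.mem_union.1 he with h | h
    · obtain ⟨f, hf, rfl⟩ := Finset.mem_image.1 h
      rw [Finset.card_map]
      exact G.uniform f hf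
    · obtain ⟨f, hf, rfl⟩ := Finset.mem_image.1 h
      rw [Finset.card_map]
      exact H.uniform f hf

/-- The hypergraph obtained from `H` by attaching one pendent edge at `v`: a new edge consisting
of `v` and `r - 1` new vertices. -/
def attachPendentEdge {r : ℕ} {V : Type} [DecidableEq V] (hr : 2 ≤ r) (H : UniformHypergraph r V)
    (v : V) : UniformHypergraph r (V ⊕ Fin (r - 1)) where
  edges := insert (insert (Sum.inl v) (Finset.univ.map Function.Embedding.inr))
    (H.edges.image (fun e => e.map Function.Embedding.inl))
  uniform := by
    intro e he
    rcases Finset.mem_insert.1 he with rfl | h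
    · rw [Finset.card_insert_of_notMem (by simp), Finset.card_map, Finset.card_univ,
        Fintype.card_fin]
      omega
    · obtain ⟨f, hf, rfl⟩ := Finset.mem_image.1 h
      rw [Finset.card_map]
      exact H.uniform f hf

/-- The vertices of the loose path of length `t`: `Sum.inl i` is `v_{i+1}` (`0 ≤ i ≤ t`), and
`Sum.inr (i, 0), …, Sum.inr (i, r-3)` are the vertices in the interior of its `i`-th edge
(`0 ≤ i < t`). -/
abbrev LoosePathVertex (r t : ℕ) : Type := Fin (t + 1) ⊕ Fin t × Fin (r - 2)

/-- The `i`-th edge `{v_{i+1}, v_{i+2}} ∪ {r - 2 interior vertices}` of a loose path. -/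
def loosePathEdge (r t : ℕ) (i : Fin t) : Finset (LoosePathVertex r t) :=
  {Sum.inl i.castSucc, Sum.inl i.succ} ∪ Finset.univ.image (fun k : Fin (r - 2) => Sum.inr (i, k))

/-- The `r`-uniform loose path of length `t`, which has `t` edges. -/
def loosePath (r : ℕ) (hr : 2 ≤ r) (t : ℕ) : UniformHypergraph r (LoosePathVertex r t) where
  edges := Finset.univ.image (loosePathEdge r t)
  uniform := by
    intro e he
    obtain ⟨i, -, rfl⟩ := Finset.mem_image.1 he
    unfold loosePathEdge
    rw [Finset.card_union_of_disjoint, Finset.card_pair, Finset.card_image_of_injective,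
      Finset.card_univ, Fintype.card_fin]
    · omega
    · intro k l hkl
      simpa using hkl
    · intro h
      exact (Fin.castSucc_lt_succ (i := i)).ne (Sum.inl.inj h)
    · rw [Finset.disjoint_left]
      intro x hx
      simp only [Finset.mem_insert, Finset.mem_singleton] at hx
      rcases hx with rfl | rfl <;> simp

/-- `Q(a, b, c)`: the loose path of length `a + b + c` with one pendent edge attached at each of
`v_{a+1}` and `v_{a+b+1}`. -/
def hyperQ (r : ℕ) (hr : 2 ≤ r) (a b c : ℕ) :
    UniformHypergraph r ((LoosePathVertex r (a + b + c) ⊕ Fin (r - 1)) ⊕ Fin (r - 1)) :=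
  ((loosePath r hr (a + b + c)).attachPendentEdge hr (Sum.inl ⟨a, by omega⟩)).attachPendentEdge hr
    (Sum.inl (Sum.inl ⟨a + b, by omega⟩))

/-- `W_n = Q(1, n - 4, 1)`, meant for `n ≥ 5`. -/
def hyperW (r : ℕ) (hr : 2 ≤ r) (n : ℕ) :
    UniformHypergraph r
      ((LoosePathVertex r (1 + (n - 4) + 1) ⊕ Fin (r - 1)) ⊕ Fin (r - 1)) :=
  hyperQ r hr 1 (n - 4) 1

/-- The disjoint union of the loose path of length `t` and `W_k`. -/
abbrev pathUnionW (r : ℕ) (hr : 2 ≤ r) (t k : ℕ) :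
    UniformHypergraph r (LoosePathVertex r t ⊕
      ((LoosePathVertex r (1 + (k - 4) + 1) ⊕ Fin (r - 1)) ⊕ Fin (r - 1))) :=
  (loosePath r hr t).disjointUnion (hyperW r hr k)

end UniformHypergraph

/-! Both invariants are computed for a general union of a path with `t` edges and `W_k`, where `k ≥
5`. Spectral radius: it equals `4 ^ (1 / r)` whatever `t` and `k` are. Multiplied by `y i`, the
eigenvalue equation at a vertex `i` says that the products of `y` over the edges at `i` add up to `λ
* y i ^ r`. On `W_k` there is an explicit positive solution with `λ = (c ^ 2)⁻¹`, `c ^ r = 1 / 2`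
(`weightSum_hyperQVector`). On the path an explicit positive vector gives `≤` for the same `λ`
(`weightSum_pathVector_le`). By a Collatz–Wielandt argument (`norm_le_of_edgeSum_le`) a positive
vector with `A y ≤ λ y ^ (r - 1)` bounds every eigenvalue, and extending the solution on `W_k` by
zero shows that `λ` is attained. Matching energy: let `p_t` be the matching generating polynomial of
a path with `t` edges. Expanding along the two pendent edges and using `p_{t+2} = p_{t+1} + X p_t`,
the polynomial of `W_k` becomes `(1 + 4X) p_{k-4}`, so that of the union is `(1 + 4X) p_t p_{k-4}`.
The two unions of the theorem have `{t, k - 4} = {m - 5, n - 5}` in the two orders, hence the same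
polynomial. They also have equally many vertices, hence the same matching polynomial. -/

namespace UniformHypergraph

/-! ### Edge sums at a vertex, pendent edges and disjoint unions -/

section EdgeSum

variable {r : ℕ} {V W : Type} [DecidableEq V] [DecidableEq W]
variable {R : Type} [CommSemiring R]

/-- `∑_{e ∋ i} ∏_{v ∈ e, v ≠ i} x_v`. -/
def edgeSum (H : UniformHypergraph r V) (x : V → R) (i : V) : R :=
  ∑ e ∈ H.edges, if i ∈ e then ∏ v ∈ e.erase i, x v else 0

/-- `∑_{e ∋ i} ∏_{v ∈ e} x_v`. -/
def weightSum (H : UniformHypergraph r V) (x : V → R) (i : V) : R :=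
  ∑ e ∈ H.edges, if i ∈ e then ∏ v ∈ e, x v else 0

/-- Passing to full edge products makes each summand independent of the vertex `i`, so an
eigenvector can be checked with one weight per edge. -/
theorem mul_edgeSum (H : UniformHypergraph r V) (x : V → R) (i : V) :
    x i * H.edgeSum x i = H.weightSum x i := by
  rw [edgeSum, weightSum, Finset.mul_sum]
  refine Finset.sum_congr rfl fun e _ => ?_
  split_ifs with h
  · exact Finset.mul_prod_erase e x h
  · exact mul_zero _

theorem pendent_notMem {s : ℕ} (hs : 0 < s) (E : Finset (Finset V)) (v : V) :
    (insert (Sum.inl v) (Finset.univ.map Function.Embedding.inr) : Finset (V ⊕ Fin s)) ∉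
      E.image (fun e => e.map Function.Embedding.inl) := by
  intro h
  obtain ⟨e, -, he⟩ := Finset.mem_image.1 h
  have : (Sum.inr ⟨0, hs⟩ : V ⊕ Fin s) ∈ e.map Function.Embedding.inl := by
    rw [he]; simp
  simp at this

theorem weightSum_attachPendentEdge_inl (hr : 2 ≤ r) (H : UniformHypergraph r V) (v : V)
    (x : V ⊕ Fin (r - 1) → R) (i : V) :
    (H.attachPendentEdge hr v).weightSum x (Sum.inl i) =
      H.weightSum (x ∘ Sum.inl) i +
        if i = v then x (Sum.inl v) * ∏ k : Fin (r - 1), x (Sum.inr k) else 0 := by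
  rw [weightSum, attachPendentEdge, Finset.sum_insert (pendent_notMem (by omega) _ _),
    Finset.sum_image (Finset.map_injective _).injOn, add_comm, weightSum]
  congr 1
  · simp
  · rw [Finset.prod_insert (by simp)]
    simp

theorem weightSum_attachPendentEdge_inr (hr : 2 ≤ r) (H : UniformHypergraph r V) (v : V)
    (x : V ⊕ Fin (r - 1) → R) (i : Fin (r - 1)) :
    (H.attachPendentEdge hr v).weightSum x (Sum.inr i) =
      x (Sum.inl v) * ∏ k : Fin (r - 1), x (Sum.inr k) := by
  rw [weightSum, attachPendentEdge, Finset.sum_insert (pendent_notMem (by omega) _ _),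
    Finset.sum_image (Finset.map_injective _).injOn]
  rw [Finset.prod_insert (by simp)]
  simp

/-- Only an empty edge could have the same image under both injections; `1 ≤ r` excludes it. -/
theorem disjoint_image_map_inl_inr (hr : 1 ≤ r) (G : UniformHypergraph r V)
    (H : UniformHypergraph r W) :
    Disjoint (G.edges.image (fun e => e.map Function.Embedding.inl))
      (H.edges.image (fun e => e.map (Function.Embedding.inr : W ↪ V ⊕ W))) := by
  rw [Finset.disjoint_left]
  intro e he he'
  obtain ⟨f, hf, rfl⟩ := Finset.mem_image.1 he
  obtain ⟨g, -, hg⟩ := Finset.mem_image.1 he'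
  obtain ⟨x, hx⟩ : f.Nonempty := by
    rw [← Finset.card_pos, G.uniform f hf]; exact hr
  have : (Sum.inl x : V ⊕ W) ∈ g.map Function.Embedding.inr := by
    rw [hg]; simpa using hx
  simp at this

theorem edgeSum_disjointUnion_inl (hr : 1 ≤ r) (G : UniformHypergraph r V)
    (H : UniformHypergraph r W) (x : V ⊕ W → R) (i : V) :
    (G.disjointUnion H).edgeSum x (Sum.inl i) = G.edgeSum (x ∘ Sum.inl) i := by
  rw [edgeSum, disjointUnion, Finset.sum_union (disjoint_image_map_inl_inr hr G H),
    Finset.sum_image (Finset.map_injective _).injOn,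
    Finset.sum_image (Finset.map_injective _).injOn, edgeSum]
  have h (e : Finset V) : (e.map Function.Embedding.inl).erase (Sum.inl i : V ⊕ W) =
      (e.erase i).map Function.Embedding.inl :=
    (Finset.map_erase Function.Embedding.inl e i).symm
  simp [-Finset.map_erase, h]

theorem edgeSum_disjointUnion_inr (hr : 1 ≤ r) (G : UniformHypergraph r V)
    (H : UniformHypergraph r W) (x : V ⊕ W → R) (i : W) :
    (G.disjointUnion H).edgeSum x (Sum.inr i) = H.edgeSum (x ∘ Sum.inr) i := by
  rw [edgeSum, disjointUnion, Finset.sum_union (disjoint_image_map_inl_inr hr G H),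
    Finset.sum_image (Finset.map_injective _).injOn,
    Finset.sum_image (Finset.map_injective _).injOn, edgeSum]
  have h (e : Finset W) : (e.map Function.Embedding.inr).erase (Sum.inr i : V ⊕ W) =
      (e.erase i).map Function.Embedding.inr :=
    (Finset.map_erase Function.Embedding.inr e i).symm
  simp [-Finset.map_erase, h]

theorem edgeSum_zero (hr : 2 ≤ r) (H : UniformHypergraph r V) (i : V) :
    H.edgeSum (0 : V → R) i = 0 := by
  refine Finset.sum_eq_zero fun e he => ?_
  split_ifs with h
  · obtain ⟨v, hv⟩ : (e.erase i).Nonempty := by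
      rw [← Finset.card_pos, Finset.card_erase_of_mem h, H.uniform e he]; omega
    exact Finset.prod_eq_zero hv rfl
  · rfl

end EdgeSum

/-! ### Adjacency tensor and bounds for its eigenvalues -/

section Tensor

variable {r : ℕ} {V : Type} [DecidableEq V]

/-- The image of `j` has at most `r - 1` elements and contains the `r - 1` elements of `e.erase i`,
so equality holds and no value is repeated. -/
theorem image_eq_erase_of_insert_image_eq {e : Finset V} (he : e.card = r) {i : V}
    {j : Fin (r - 1) → V} (h : insert i (Finset.univ.image j) = e) :
    Finset.univ.image j = e.erase i ∧ Function.Injective j := by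
  have hi : i ∈ e := h ▸ Finset.mem_insert_self _ _
  have hc : (e.erase i).card = r - 1 := by rw [Finset.card_erase_of_mem hi, he]
  have hsub : e.erase i ⊆ Finset.univ.image j := by
    rw [← h]; exact Finset.erase_insert_subset _ _
  have hle : (Finset.univ.image j).card ≤ r - 1 := by
    simpa using Finset.card_image_le (s := Finset.univ) (f := j)
  have heq := Finset.eq_of_subset_of_card_le hsub (by omega)
  refine ⟨heq.symm, ?_⟩
  have : (Finset.univ.image j).card = (Finset.univ : Finset (Fin (r - 1))).card := by
    rw [← heq, hc]; simp
  have h2 := Finset.card_image_iff.1 this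
  intro a b hab
  exact h2 (by simp) (by simp) hab

variable [Fintype V]

/-- The contributing index tuples are the `(r - 1)!` orderings of `e.erase i`, and each gives the
same product. This factor cancels the normalisation of the adjacency tensor. -/
theorem sum_prod_of_insert_image_eq {e : Finset V} (he : e.card = r) {i : V}
    (hi : i ∈ e) (x : V → ℂ) :
    (∑ j : Fin (r - 1) → V, if insert i (Finset.univ.image j) = e then ∏ k, x (j k) else 0) =
      ((r - 1).factorial : ℂ) * ∏ v ∈ e.erase i, x v := by
  have hc : Fintype.card (e.erase i) = r - 1 := by
    rw [Fintype.card_coe, Finset.card_erase_of_mem hi, he]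
  rw [← Finset.sum_filter]
  have hcard : (Finset.univ.filter fun j : Fin (r - 1) → V =>
      insert i (Finset.univ.image j) = e).card = (r - 1).factorial := by
    have : (r - 1).factorial = Fintype.card (Fin (r - 1) ≃ e.erase i) := by
      rw [Fintype.card_equiv (Fintype.equivFinOfCardEq hc).symm, Fintype.card_fin]
    rw [this, ← Finset.card_univ]
    symm
    refine Finset.card_bij (fun σ _ k => (σ k : V)) ?_ ?_ ?_
    · intro σ _
      refine Finset.mem_filter.2 ⟨Finset.mem_univ _, ?_⟩
      have : Finset.univ.image (fun k => (σ k : V)) = e.erase i := by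
        ext v
        simp only [Finset.mem_image, Finset.mem_univ, true_and]
        constructor
        · rintro ⟨k, rfl⟩
          exact (σ k).2
        · intro hv
          exact ⟨σ.symm ⟨v, hv⟩, by simp⟩
      rw [this, Finset.insert_erase hi]
    · intro σ _ τ _ h
      ext k
      exact congrFun h k
    · intro j hj
      obtain ⟨him, hinj⟩ := image_eq_erase_of_insert_image_eq he (Finset.mem_filter.1 hj).2
      have hm (k) : j k ∈ e.erase i := by
        rw [← him]; exact Finset.mem_image_of_mem _ (Finset.mem_univ _)
      refine ⟨Equiv.ofBijective (fun k => ⟨j k, hm k⟩) ?_, Finset.mem_univ _, rfl⟩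
      rw [Fintype.bijective_iff_injective_and_card, hc, Fintype.card_fin]
      exact ⟨fun a b hab => hinj (congrArg Subtype.val hab), rfl⟩
  rw [Finset.sum_congr rfl (g := fun _ => ∏ v ∈ e.erase i, x v), Finset.sum_const, hcard,
    nsmul_eq_mul]
  intro j hj
  obtain ⟨him, hinj⟩ := image_eq_erase_of_insert_image_eq he (Finset.mem_filter.1 hj).2
  rw [← him, Finset.prod_image hinj.injOn]

theorem adjacencyTensor_apply (H : UniformHypergraph r V) (x : V → ℂ) (i : V) :
    H.adjacencyTensor.apply x i = H.edgeSum x i := by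
  have hf : ((r - 1).factorial : ℂ) ≠ 0 := Nat.cast_ne_zero.2 (Nat.factorial_ne_zero _)
  have h1 (j : Fin (r - 1) → V) : (H.adjacencyTensor i j : ℂ) * ∏ k, x (j k) =
      ∑ e ∈ H.edges, ((r - 1).factorial : ℂ)⁻¹ *
        if insert i (Finset.univ.image j) = e then ∏ k, x (j k) else 0 := by
    rw [← Finset.mul_sum, Finset.sum_ite_eq, adjacencyTensor]
    split_ifs <;> simp
  rw [RealTensor.apply, Finset.sum_congr rfl fun j _ => h1 j, Finset.sum_comm, edgeSum]
  refine Finset.sum_congr rfl fun e he => ?_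
  rw [← Finset.mul_sum]
  split_ifs with hi
  · rw [sum_prod_of_insert_image_eq (H.uniform e he) hi, inv_mul_cancel_left₀ hf]
  · rw [Finset.sum_eq_zero, mul_zero]
    intro j _
    rw [if_neg]
    rintro rfl
    exact hi (Finset.mem_insert_self _ _)

/-- A positive vector `y` with `A y ≤ b y ^ (r - 1)` bounds the modulus of all eigenvalues. -/
theorem norm_le_of_edgeSum_le (H : UniformHypergraph r V) {b : ℝ} {y : V → ℝ}
    (hy : ∀ i, 0 < y i) (h : ∀ i, H.edgeSum y i ≤ b * y i ^ (r - 1)) {μ : ℂ}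
    (hμ : H.adjacencyTensor.IsEigenvalue μ) : ‖μ‖ ≤ b := by
  obtain ⟨x, hx0, hx⟩ := hμ
  obtain ⟨i₀, hi₀⟩ := Function.ne_iff.1 hx0
  -- At a vertex maximising `‖x i‖ / y i` the vector `‖x‖` is dominated by `c * y` with equality at
  -- `i`, so the equation at `i` compares `‖μ‖` with `b`.
  obtain ⟨i, -, hi⟩ := Finset.exists_max_image Finset.univ (fun i => ‖x i‖ / y i)
    ⟨i₀, Finset.mem_univ _⟩
  set c := ‖x i‖ / y i with hc
  have hcpos : 0 < c :=
    (div_pos (norm_pos_iff.2 hi₀) (hy i₀)).trans_le (hi i₀ (Finset.mem_univ _))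
  have hxle (v : V) : ‖x v‖ ≤ c * y v := (div_le_iff₀ (hy v)).1 (hi v (Finset.mem_univ _))
  have hxi : ‖x i‖ = c * y i := by rw [hc, div_mul_cancel₀ _ (hy i).ne']
  have h1 : ‖μ‖ * ‖x i‖ ^ (r - 1) ≤ c ^ (r - 1) * H.edgeSum y i := by
    rw [← norm_pow, ← norm_mul, ← hx i, adjacencyTensor_apply, edgeSum, edgeSum,
      Finset.mul_sum]
    refine norm_sum_le_of_le _ fun e he => ?_
    split_ifs with hie
    · have hcard : (e.erase i).card = r - 1 := by
        rw [Finset.card_erase_of_mem hie, H.uniform e he]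
      rw [norm_prod, ← hcard, ← Finset.prod_const, ← Finset.prod_mul_distrib]
      exact Finset.prod_le_prod (fun _ _ => norm_nonneg _) fun v _ => hxle v
    · simp
  rw [hxi, mul_pow] at h1
  have h2 := h1.trans (mul_le_mul_of_nonneg_left (h i) (pow_nonneg hcpos.le _))
  have h3 : 0 < c ^ (r - 1) * y i ^ (r - 1) := mul_pos (pow_pos hcpos _) (pow_pos (hy i) _)
  refine le_of_mul_le_mul_right ?_ h3
  linarith

theorem isEigenvalue_of_edgeSum_eq (H : UniformHypergraph r V) {b : ℝ} {y : V → ℝ}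
    (hy : y ≠ 0) (h : ∀ i, H.edgeSum y i = b * y i ^ (r - 1)) :
    H.adjacencyTensor.IsEigenvalue (b : ℂ) := by
  obtain ⟨i₀, hi₀⟩ := Function.ne_iff.1 hy
  refine ⟨fun i => (y i : ℂ), Function.ne_iff.2 ⟨i₀, by simpa using hi₀⟩, fun i => ?_⟩
  rw [adjacencyTensor_apply, ← Complex.ofReal_pow, ← Complex.ofReal_mul, ← h i]
  simp only [edgeSum]
  push_cast
  refine Finset.sum_congr rfl fun e _ => ?_
  split_ifs <;> simp

end Tensor

/-! ### Explicit vectors on the path and on `Q(1, b, 1)` -/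

section Weights

variable {r : ℕ}

theorem weightSum_loosePath (hr : 2 ≤ r) (t : ℕ) (x : LoosePathVertex r t → ℝ)
    (i : LoosePathVertex r t) :
    (loosePath r hr t).weightSum x i = ∑ j : Fin t, if i ∈ loosePathEdge r t j then
      x (Sum.inl j.castSucc) * x (Sum.inl j.succ) * ∏ k : Fin (r - 2), x (Sum.inr (j, k)) else 0 := by
  have hinj : Function.Injective (loosePathEdge r t) := by
    intro a b hab
    have h1 : Sum.inl a.castSucc ∈ loosePathEdge r t b := by
      rw [← hab]; simp [loosePathEdge]
    have h2 : Sum.inl a.succ ∈ loosePathEdge r t b := by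
      rw [← hab]; simp [loosePathEdge]
    simp [loosePathEdge, Fin.ext_iff] at h1 h2
    omega
  rw [weightSum, loosePath, Finset.sum_image hinj.injOn]
  refine Finset.sum_congr rfl fun j _ => ?_
  congr 1
  rw [loosePathEdge, Finset.prod_union, Finset.prod_pair, Finset.prod_image]
  · intro k _ l _ hkl
    simpa using hkl
  · intro h
    exact (Fin.castSucc_lt_succ (i := j)).ne (Sum.inl.inj h)
  · rw [Finset.disjoint_left]
    intro v hv
    simp only [Finset.mem_insert, Finset.mem_singleton] at hv
    rcases hv with rfl | rfl <;> simp

/-- The sum of a weight over the edges of a path with `t` edges at its vertex `i`. -/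
theorem sum_fin_incident (t i : ℕ) (w : ℕ → ℝ) :
    (∑ j : Fin t, if i = j.val ∨ i = j.val + 1 then w j else 0) =
      (if i < t then w i else 0) + if 0 < i ∧ i ≤ t then w (i - 1) else 0 := by
  rw [Fin.sum_univ_eq_sum_range (fun j => if i = j ∨ i = j + 1 then w j else 0) t]
  -- For `i = 0` the truncated `i - 1` is again `0`; the inner test `0 < i` removes this spurious
  -- term.
  have h (j : ℕ) : (if i = j ∨ i = j + 1 then w j else 0) =
      (if i = j then w j else 0) + if i - 1 = j then (if 0 < i then w j else 0) else 0 := by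
    split_ifs <;> first | omega | simp
  rw [Finset.sum_congr rfl fun j _ => h j, Finset.sum_add_distrib, Finset.sum_ite_eq,
    Finset.sum_ite_eq]
  simp only [Finset.mem_range]
  congr 1
  split_ifs <;> first | rfl | omega

theorem weightSum_loosePath_inl (hr : 2 ≤ r) (t : ℕ) (x : LoosePathVertex r t → ℝ) (w : ℕ → ℝ)
    (hw : ∀ j : Fin t, x (Sum.inl j.castSucc) * x (Sum.inl j.succ) *
      ∏ k : Fin (r - 2), x (Sum.inr (j, k)) = w j) (i : Fin (t + 1)) :
    (loosePath r hr t).weightSum x (Sum.inl i) =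
      (if i.val < t then w i else 0) + if 0 < i.val then w (i - 1) else 0 := by
  have h := sum_fin_incident t i w
  have hi : i.val ≤ t := by omega
  simp only [hi, and_true] at h
  rw [weightSum_loosePath, ← h]
  refine Finset.sum_congr rfl fun j _ => ?_
  rw [hw j]
  simp [loosePathEdge, Fin.ext_iff]

theorem weightSum_loosePath_inr (hr : 2 ≤ r) (t : ℕ) (x : LoosePathVertex r t → ℝ) (w : ℕ → ℝ)
    (hw : ∀ j : Fin t, x (Sum.inl j.castSucc) * x (Sum.inl j.succ) *
      ∏ k : Fin (r - 2), x (Sum.inr (j, k)) = w j) (i : Fin t × Fin (r - 2)) :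
    (loosePath r hr t).weightSum x (Sum.inr i) = w i.1 := by
  obtain ⟨a, l⟩ := i
  rw [weightSum_loosePath, Finset.sum_eq_single a]
  · rw [hw a]
    simp [loosePathEdge]
  · intro j _ hj
    simp [loosePathEdge, hj]
  · simp

/-- A positive vector on the loose path which witnesses `ρ ≤ (c ^ 2)⁻¹` when `c ^ r = 1 / 2`. -/
def pathVector (r t : ℕ) (c : ℝ) : LoosePathVertex r t → ℝ :=
  Sum.elim (fun _ => 1) (fun _ => c)

/-- The Perron vector of `Q(1, b, 1)` for the eigenvalue `(c ^ 2)⁻¹` when `c ^ r = 1 / 2`. -/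
def hyperQVector (r b : ℕ) (c : ℝ) :
    (LoosePathVertex r (1 + b + 1) ⊕ Fin (r - 1)) ⊕ Fin (r - 1) → ℝ :=
  Sum.elim (Sum.elim (Sum.elim (fun j => if j.val = 0 ∨ j.val = b + 2 then c ^ 2 else 1)
    (fun j => if j.1.val = 0 ∨ j.1.val = b + 1 then c ^ 2 else c)) (fun _ => c ^ 2))
    (fun _ => c ^ 2)

theorem pathVector_pos {t : ℕ} {c : ℝ} (hc : 0 < c) (i : LoosePathVertex r t) :
    0 < pathVector r t c i := by
  rcases i with i | i <;> simp [pathVector, hc]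

theorem hyperQVector_pos {b : ℕ} {c : ℝ} (hc : 0 < c)
    (i : (LoosePathVertex r (1 + b + 1) ⊕ Fin (r - 1)) ⊕ Fin (r - 1)) :
    0 < hyperQVector r b c i := by
  have := pow_pos hc 2
  rcases i with ((i | i) | i) | i <;> simp only [hyperQVector, Sum.elim_inl, Sum.elim_inr] <;>
    first | assumption | (split_ifs <;> first | assumption | exact one_pos)

theorem pow_sub_two_eq {c : ℝ} (hr : 2 ≤ r) (hc : 0 < c) (hcr : c ^ r = 1 / 2) :
    c ^ (r - 2) = (c ^ 2)⁻¹ * (1 / 2) := by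
  rw [← hcr, pow_sub₀ c hc.ne' hr, mul_comm]

theorem sq_pow_sub_one_eq {c : ℝ} (hr : 2 ≤ r) (hc : 0 < c) (hcr : c ^ r = 1 / 2) :
    (c ^ 2) ^ (r - 1) = (c ^ 2)⁻¹ * (1 / 4) := by
  rw [pow_sub₀ _ (pow_pos hc 2).ne' (by omega), pow_right_comm, hcr]
  norm_num [mul_comm]

/-- In units of `(c ^ 2)⁻¹` every edge has weight `1 / 2`. An interior vertex has `c ^ r = 1 / 2` on
the right, and a vertex `v_i` has `1` there against at most two edges. -/
theorem weightSum_pathVector_le {t : ℕ} {c : ℝ} (hr : 2 ≤ r) (hc : 0 < c)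
    (hcr : c ^ r = 1 / 2) (i : LoosePathVertex r t) :
    (loosePath r hr t).weightSum (pathVector r t c) i ≤ (c ^ 2)⁻¹ * pathVector r t c i ^ r := by
  have hpos : 0 < (c ^ 2)⁻¹ := inv_pos.2 (pow_pos hc 2)
  have hw : ∀ j : Fin t, pathVector r t c (Sum.inl j.castSucc) *
      pathVector r t c (Sum.inl j.succ) * ∏ k : Fin (r - 2), pathVector r t c (Sum.inr (j, k)) =
        (fun _ => (c ^ 2)⁻¹ * (1 / 2)) j.val := by
    intro j
    simp only [pathVector, Sum.elim_inl, Sum.elim_inr, Finset.prod_const, Finset.card_univ,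
      Fintype.card_fin, pow_sub_two_eq hr hc hcr, one_mul]
  rcases i with i | i
  · rw [weightSum_loosePath_inl hr t _ (fun _ => (c ^ 2)⁻¹ * (1 / 2)) hw]
    simp only [pathVector, Sum.elim_inl, one_pow]
    split_ifs <;> linarith
  · rw [weightSum_loosePath_inr hr t _ (fun _ => (c ^ 2)⁻¹ * (1 / 2)) hw]
    simp only [pathVector, Sum.elim_inr, hcr, le_refl]

/-- In units of `(c ^ 2)⁻¹`, the four outer edges (two pendent ones, first and last path edge) have
weight `1 / 4` and the other path edges `1 / 2`. The sums balance: `1/2 + 1/4 + 1/4 = 1` at the two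
branching vertices, `1/2 + 1/2 = 1` at the `v_i` strictly between them, and `(c ^ 2) ^ r = 1 / 4` or
`c ^ r = 1 / 2` at vertices of degree one. -/
theorem weightSum_hyperQVector {b : ℕ} {c : ℝ} (hr : 2 ≤ r) (hb : 1 ≤ b) (hc : 0 < c)
    (hcr : c ^ r = 1 / 2) (i : (LoosePathVertex r (1 + b + 1) ⊕ Fin (r - 1)) ⊕ Fin (r - 1)) :
    (hyperQ r hr 1 b 1).weightSum (hyperQVector r b c) i =
      (c ^ 2)⁻¹ * hyperQVector r b c i ^ r := by
  have hA := pow_sub_two_eq hr hc hcr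
  have hB := sq_pow_sub_one_eq hr hc hcr
  have hC : (c ^ 2) ^ r = 1 / 4 := by rw [pow_right_comm, hcr]; norm_num
  have hB' : c ^ 2 * (c ^ 2) ^ (r - 2) = (c ^ 2)⁻¹ * (1 / 4) := by
    rw [← hB, ← pow_succ']; congr 1; omega
  obtain ⟨w, hw_def⟩ : ∃ w : ℕ → ℝ, w = fun j =>
      if j = 0 ∨ j = b + 1 then (c ^ 2)⁻¹ * (1 / 4) else (c ^ 2)⁻¹ * (1 / 2) := ⟨_, rfl⟩
  have hw : ∀ j : Fin (1 + b + 1),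
      hyperQVector r b c (Sum.inl (Sum.inl (Sum.inl j.castSucc))) *
      hyperQVector r b c (Sum.inl (Sum.inl (Sum.inl j.succ))) *
        ∏ k : Fin (r - 2), hyperQVector r b c (Sum.inl (Sum.inl (Sum.inr (j, k)))) =
        w j.val := by
    rintro ⟨j, hj⟩
    simp only [hw_def, hyperQVector, Sum.elim_inl, Sum.elim_inr, Fin.val_castSucc, Fin.val_succ]
    split_ifs <;> simp only [false_or] at * <;>
      first | omega | simpa using hA | simpa using hB'
  have hv (k : ℕ) (hk : k < 1 + b + 1 + 1) (h0 : k ≠ 0) (h1 : k ≠ b + 2) :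
      hyperQVector r b c (Sum.inl (Sum.inl (Sum.inl ⟨k, hk⟩))) = 1 := by
    simp [hyperQVector, h0, h1]
  rw [hyperQ]
  rcases i with ((i | i) | i) | i
  · rw [weightSum_attachPendentEdge_inl, weightSum_attachPendentEdge_inl,
      weightSum_loosePath_inl hr _ _ w hw, hw_def]
    simp only [Function.comp_apply]
    rw [hv _ _ (by omega) (by omega), hv _ _ (by omega) (by omega)]
    simp only [hyperQVector, Sum.elim_inl, Sum.elim_inr, Finset.prod_const, Finset.card_univ,
      Fintype.card_fin, Sum.inl.injEq, Fin.ext_iff, hB]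
    obtain ⟨i, hi⟩ := i
    simp only
    -- The two ends, the two branching vertices, and the path vertices strictly between them.
    have hi' : i = 0 ∨ i = 1 ∨ (2 ≤ i ∧ i ≤ b) ∨ i = 1 + b ∨ i = b + 2 := by omega
    split_ifs <;> first | omega | (simp only [hC, one_pow]; ring)
  · rw [weightSum_attachPendentEdge_inl, weightSum_attachPendentEdge_inl,
      weightSum_loosePath_inr hr _ _ w hw, hw_def]
    simp only [hyperQVector, Sum.elim_inl, Sum.elim_inr, Sum.inl.injEq, reduceCtorEq, if_false,
      add_zero]
    split_ifs <;> simp only [hC, hcr]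
  · rw [weightSum_attachPendentEdge_inl, weightSum_attachPendentEdge_inr]
    simp only [Function.comp_apply]
    rw [hv _ _ (by omega) (by omega)]
    simp [hyperQVector, hB, hC]
  · rw [weightSum_attachPendentEdge_inr, hv _ _ (by omega) (by omega)]
    simp [hyperQVector, hB, hC]

/-- The spectral radius of the union of a loose path and `W_k` is attained. -/
theorem isGreatest_eigenvalueModuli_pathUnionW {c : ℝ} (hr : 2 ≤ r) (hc : 0 < c)
    (hcr : c ^ r = 1 / 2) (t : ℕ) {k : ℕ} (hk : 5 ≤ k) :
    IsGreatest (pathUnionW r hr t k).adjacencyTensor.eigenvalueModuli (c ^ 2)⁻¹ := by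
  have hpow (z : ℝ) : (c ^ 2)⁻¹ * z ^ r = z * ((c ^ 2)⁻¹ * z ^ (r - 1)) := by
    rw [mul_left_comm, ← pow_succ', Nat.sub_add_cancel (by omega)]
  have hP (i) : (loosePath r hr t).edgeSum (pathVector r t c) i ≤
      (c ^ 2)⁻¹ * pathVector r t c i ^ (r - 1) := by
    refine le_of_mul_le_mul_left ?_ (pathVector_pos hc i)
    rw [mul_edgeSum, ← hpow]
    exact weightSum_pathVector_le hr hc hcr i
  have hW (i) : (hyperW r hr k).edgeSum (hyperQVector r (k - 4) c) i =
      (c ^ 2)⁻¹ * hyperQVector r (k - 4) c i ^ (r - 1) := by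
    refine mul_left_cancel₀ (hyperQVector_pos hc i).ne' ?_
    rw [mul_edgeSum, ← hpow]
    exact weightSum_hyperQVector hr (by omega) hc hcr i
  have hr1 : 1 ≤ r := by omega
  constructor
  -- The eigenvector vanishes on the path, where the bound need not be attained.
  · refine ⟨(((c ^ 2)⁻¹ : ℝ) : ℂ), isEigenvalue_of_edgeSum_eq _
      (y := Sum.elim 0 (hyperQVector r (k - 4) c)) ?_ ?_, ?_⟩
    · intro h
      have h0 := congrFun h (Sum.inr (Sum.inr ⟨0, by omega⟩))
      exact (hyperQVector_pos (r := r) (b := k - 4) hc (Sum.inr ⟨0, by omega⟩)).ne' h0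
    · rintro (i | i)
      · rw [edgeSum_disjointUnion_inl hr1, Sum.elim_comp_inl, edgeSum_zero hr, Sum.elim_inl,
          Pi.zero_apply, zero_pow (by omega), mul_zero]
      · rw [edgeSum_disjointUnion_inr hr1, Sum.elim_comp_inr, hW, Sum.elim_inr]
    · rw [Complex.norm_real, Real.norm_of_nonneg (inv_nonneg.2 (sq_nonneg c))]
  · rintro _ ⟨μ, hμ, rfl⟩
    refine norm_le_of_edgeSum_le _
      (y := Sum.elim (pathVector r t c) (hyperQVector r (k - 4) c)) ?_ ?_ hμ
    · rintro (i | i)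
      · exact pathVector_pos hc i
      · exact hyperQVector_pos hc i
    · rintro (i | i)
      · rw [edgeSum_disjointUnion_inl hr1, Sum.elim_comp_inl, Sum.elim_inl]
        exact hP i
      · rw [edgeSum_disjointUnion_inr hr1, Sum.elim_comp_inr, Sum.elim_inr]
        exact (hW i).le

end Weights

end UniformHypergraph

/-! ### Matching generating polynomials of set families -/

open Polynomial

/-- The generating polynomial `∑_M X ^ |M|` of the sets `M ⊆ E` of pairwise disjoint members. -/
noncomputable def matchingGenPoly {V : Type} [DecidableEq V] (E : Finset (Finset V)) : ℤ[X] :=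
  ∑ M ∈ E.powerset.filter (fun M => ∀ e ∈ M, ∀ f ∈ M, e ≠ f → Disjoint e f), X ^ M.card

section MatchingGenPoly

variable {V W : Type} [DecidableEq V] [DecidableEq W]

@[simp]
theorem matchingGenPoly_empty : matchingGenPoly (∅ : Finset (Finset V)) = 1 := by
  rw [matchingGenPoly, Finset.powerset_empty, Finset.filter_singleton]
  simp

/-- Matchings are split by whether they use `e`; those that do are `e` together with a matching of
the members disjoint from `e`. -/
theorem matchingGenPoly_insert {E : Finset (Finset V)} {e : Finset V} (he : e ∉ E) :
    matchingGenPoly (insert e E) =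
      matchingGenPoly E + X * matchingGenPoly (E.filter (Disjoint e)) := by
  unfold matchingGenPoly
  simp only [Finset.sum_filter, Finset.sum_powerset_insert he, Finset.mul_sum]
  congr 1
  have hsub : (E.filter (Disjoint e)).powerset ⊆ E.powerset :=
    Finset.powerset_mono.2 (Finset.filter_subset _ _)
  rw [← Finset.sum_subset hsub]
  · refine Finset.sum_congr rfl fun M hM => ?_
    have hME : ∀ f ∈ M, f ∈ E ∧ Disjoint e f := fun f hf => by
      simpa using Finset.mem_powerset.1 hM hf
    have heM : e ∉ M := fun h => he (hME e h).1
    have key : (∀ f ∈ insert e M, ∀ g ∈ insert e M, f ≠ g → Disjoint f g) ↔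
        (∀ f ∈ M, ∀ g ∈ M, f ≠ g → Disjoint f g) := by
      constructor
      · intro h f hf g hg
        exact h f (Finset.mem_insert_of_mem hf) g (Finset.mem_insert_of_mem hg)
      · intro h f hf g hg hfg
        rcases Finset.mem_insert.1 hf with rfl | hf'
        · rcases Finset.mem_insert.1 hg with rfl | hg'
          · exact absurd rfl hfg
          · exact (hME g hg').2
        · rcases Finset.mem_insert.1 hg with rfl | hg'
          · exact (hME f hf').2.symm
          · exact h f hf' g hg' hfg
    rw [Finset.card_insert_of_notMem heM]
    by_cases h : ∀ f ∈ M, ∀ g ∈ M, f ≠ g → Disjoint f g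
    · rw [if_pos (key.2 h), if_pos h, pow_succ']
    · rw [if_neg (fun h' => h (key.1 h')), if_neg h, mul_zero]
  · intro M hM hM'
    rw [if_neg]
    intro h
    apply hM'
    rw [Finset.mem_powerset]
    intro f hf
    have hfE := Finset.mem_powerset.1 hM hf
    refine Finset.mem_filter.2 ⟨hfE, h e (Finset.mem_insert_self _ _) f
      (Finset.mem_insert_of_mem hf) ?_⟩
    rintro rfl
    exact he hfE

theorem matchingGenPoly_image_map (φ : V ↪ W) (E : Finset (Finset V)) :
    matchingGenPoly (E.image (fun e => e.map φ)) = matchingGenPoly E := by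
  induction hn : E.card using Nat.strong_induction_on generalizing E with
  | _ n ih =>
    subst hn
    rcases E.eq_empty_or_nonempty with rfl | ⟨e, he⟩
    · simp
    · obtain ⟨F, heF, rfl⟩ : ∃ F, e ∉ F ∧ insert e F = E :=
        ⟨E.erase e, Finset.notMem_erase _ _, Finset.insert_erase he⟩
      have hc : F.card < (insert e F).card := by
        rw [Finset.card_insert_of_notMem heF]; omega
      have hinj : Function.Injective (fun e : Finset V => e.map φ) := Finset.map_injective φ
      rw [Finset.image_insert, matchingGenPoly_insert, matchingGenPoly_insert heF, ih _ hc F rfl,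
        Finset.filter_image]
      · simp only [Finset.disjoint_map]
        rw [ih _ ((Finset.card_filter_le _ _).trans_lt hc) _ rfl]
      · rw [hinj.mem_finset_image]
        exact heF

/-- Both sides obey the same recursion when a member of `E` is split off. The hypothesis `hEF` is
not implied by `h`, since the empty set is disjoint from itself. -/
theorem matchingGenPoly_union {E F : Finset (Finset V)} (hEF : Disjoint E F)
    (h : ∀ e ∈ E, ∀ f ∈ F, Disjoint e f) :
    matchingGenPoly (E ∪ F) = matchingGenPoly E * matchingGenPoly F := by
  induction hn : E.card using Nat.strong_induction_on generalizing E with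
  | _ n ih =>
    subst hn
    rcases E.eq_empty_or_nonempty with rfl | ⟨e, he⟩
    · simp
    · obtain ⟨E', heE, rfl⟩ : ∃ F, e ∉ F ∧ insert e F = E :=
        ⟨E.erase e, Finset.notMem_erase _ _, Finset.insert_erase he⟩
      have hc : E'.card < (insert e E').card := by
        rw [Finset.card_insert_of_notMem heE]; omega
      have hd := Finset.disjoint_insert_left.1 hEF
      have hF : F.filter (Disjoint e) = F :=
        Finset.filter_true_of_mem fun f hf => h e (Finset.mem_insert_self _ _) f hf
      have h' : ∀ f ∈ E', ∀ g ∈ F, Disjoint f g := fun f hf =>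
        h f (Finset.mem_insert_of_mem hf)
      rw [Finset.insert_union, matchingGenPoly_insert, matchingGenPoly_insert heE,
        ih _ hc hd.2 h' rfl, Finset.filter_union, hF,
        ih _ ((Finset.card_filter_le _ _).trans_lt hc)
          (Finset.disjoint_of_subset_left (Finset.filter_subset _ _) hd.2)
          (fun f hf => h' f (Finset.mem_filter.1 hf).1) rfl]
      · ring
      · simp [heE, hd.1]

end MatchingGenPoly

/-! ### Matching polynomials of paths and of `W_k` -/

/-- The matching generating polynomial of a path with `t` edges. -/
noncomputable def pathGenPoly : ℕ → ℤ[X]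
  | 0 => 1
  | 1 => 1 + X
  | t + 2 => pathGenPoly (t + 1) + X * pathGenPoly t

/-- Only consecutive sets meet. Splitting off the last one leaves a shorter interval, or an interval
shorter by one more if that set is used; this is the recursion of `pathGenPoly`. Intervals with
arbitrary left end are needed for the pieces left after deleting a vertex. -/
theorem matchingGenPoly_image_Ico {V : Type} [DecidableEq V] (e : ℕ → Finset V) (N : ℕ)
    (hinj : ∀ i j, i < j → j < N → e i ≠ e j)
    (hd : ∀ i j, i < j → j < N → (Disjoint (e i) (e j) ↔ j ≠ i + 1)) (a l : ℕ)
    (hl : a + l ≤ N) :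
    matchingGenPoly ((Finset.Ico a (a + l)).image e) = pathGenPoly l := by
  induction l using Nat.strong_induction_on with
  | _ l ih =>
    have step : ∀ b, a ≤ b → b < N →
        matchingGenPoly ((Finset.Ico a (b + 1)).image e) =
          matchingGenPoly ((Finset.Ico a b).image e) +
            X * matchingGenPoly ((Finset.Ico a (b - 1)).image e) := by
      intro b hab hb
      have hI : Finset.Ico a (b + 1) = insert b (Finset.Ico a b) := by
        ext k; simp only [Finset.mem_Ico, Finset.mem_insert]; omega
      rw [hI, Finset.image_insert, matchingGenPoly_insert, Finset.filter_image]
      · congr 4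
        ext k
        simp only [Finset.mem_filter, Finset.mem_Ico]
        constructor
        · rintro ⟨hk, hdis⟩
          have := (hd k b hk.2 hb).1 hdis.symm
          omega
        · intro hk
          exact ⟨by omega, ((hd k b (by omega) hb).2 (by omega)).symm⟩
      · simp only [Finset.mem_image, Finset.mem_Ico, not_exists, not_and]
        intro k hk
        exact hinj k b hk.2 hb
    match l, ih, hl with
    | 0, _, _ => simp [pathGenPoly]
    | 1, _, hl =>
      rw [step a le_rfl (by omega), Finset.Ico_eq_empty_of_le (Nat.sub_le a 1)]
      simp [pathGenPoly]
    | l + 2, ih, hl =>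
      rw [show a + (l + 2) = a + (l + 1) + 1 by ring, step (a + (l + 1)) (by omega) (by omega),
        ih (l + 1) (by omega) (by omega), show a + (l + 1) - 1 = a + l by omega,
        ih l (by omega) (by omega), pathGenPoly]

namespace UniformHypergraph

/-- The edges of a loose path, indexed by all natural numbers. -/
def loosePathEdgeNat (r t i : ℕ) : Finset (LoosePathVertex r t) :=
  if h : i < t then loosePathEdge r t ⟨i, h⟩ else ∅

theorem inl_mem_loosePathEdgeNat {r t i : ℕ} (h : i < t) (k : Fin (t + 1)) :
    (Sum.inl k : LoosePathVertex r t) ∈ loosePathEdgeNat r t i ↔ k.val = i ∨ k.val = i + 1 := by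
  simp [loosePathEdgeNat, h, loosePathEdge, Fin.ext_iff]

theorem inr_mem_loosePathEdgeNat {r t i : ℕ} (h : i < t) (k : Fin t × Fin (r - 2)) :
    (Sum.inr k : LoosePathVertex r t) ∈ loosePathEdgeNat r t i ↔ k.1.val = i := by
  obtain ⟨a, b⟩ := k
  simp [loosePathEdgeNat, h, loosePathEdge, Fin.ext_iff, eq_comm]

theorem loosePathEdgeNat_ne {r t i j : ℕ} (hij : i < j) (hj : j < t) :
    loosePathEdgeNat r t i ≠ loosePathEdgeNat r t j := by
  intro h
  have h1 := (inl_mem_loosePathEdgeNat (r := r) (hij.trans hj) ⟨i, by omega⟩).2 (Or.inl rfl)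
  rw [h, inl_mem_loosePathEdgeNat hj] at h1
  simp only at h1
  omega

theorem disjoint_loosePathEdgeNat_iff {r t i j : ℕ} (hij : i < j) (hj : j < t) :
    Disjoint (loosePathEdgeNat r t i) (loosePathEdgeNat r t j) ↔ j ≠ i + 1 := by
  rw [Finset.disjoint_left]
  constructor
  · rintro h rfl
    exact h ((inl_mem_loosePathEdgeNat (hij.trans hj) ⟨i + 1, by omega⟩).2 (Or.inr rfl))
      ((inl_mem_loosePathEdgeNat hj ⟨i + 1, by omega⟩).2 (Or.inl rfl))
  · rintro h (x | x) hx hx'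
    · rw [inl_mem_loosePathEdgeNat (hij.trans hj)] at hx
      rw [inl_mem_loosePathEdgeNat hj] at hx'
      omega
    · rw [inr_mem_loosePathEdgeNat (hij.trans hj)] at hx
      rw [inr_mem_loosePathEdgeNat hj] at hx'
      omega

theorem loosePath_edges {r : ℕ} (hr : 2 ≤ r) (t : ℕ) :
    (loosePath r hr t).edges = (Finset.Ico 0 (0 + t)).image (loosePathEdgeNat r t) := by
  ext e
  simp only [loosePath, Finset.mem_image, Finset.mem_univ, true_and, Finset.mem_Ico]
  constructor
  · rintro ⟨i, rfl⟩
    exact ⟨i, by omega, by simp [loosePathEdgeNat]⟩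
  · rintro ⟨i, hi, rfl⟩
    have : i < t := by omega
    exact ⟨⟨i, this⟩, by simp [loosePathEdgeNat, this]⟩

theorem matchingGenPoly_image_loosePathEdgeNat {r t : ℕ} (a l : ℕ) (h : a + l ≤ t) :
    matchingGenPoly ((Finset.Ico a (a + l)).image (loosePathEdgeNat r t)) = pathGenPoly l :=
  matchingGenPoly_image_Ico _ t (fun _ _ => loosePathEdgeNat_ne)
    (fun _ _ => disjoint_loosePathEdgeNat_iff) a l h

/-- The edge set obtained from `E` by adding a pendent edge with `s` new vertices at `v`. -/
def addPendent {V : Type} [DecidableEq V] (s : ℕ) (E : Finset (Finset V)) (v : V) :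
    Finset (Finset (V ⊕ Fin s)) :=
  insert (insert (Sum.inl v) (Finset.univ.map Function.Embedding.inr))
    (E.image (fun e => e.map Function.Embedding.inl))

section Pendent

variable {V : Type} [DecidableEq V] {s : ℕ}

/-- The pendent edge meets an old edge exactly when that edge contains `v`. -/
theorem matchingGenPoly_addPendent (hs : 0 < s) (E : Finset (Finset V)) (v : V) :
    matchingGenPoly (addPendent s E v) =
      matchingGenPoly E + X * matchingGenPoly (E.filter (v ∉ ·)) := by
  rw [addPendent, matchingGenPoly_insert (pendent_notMem hs E v), Finset.filter_image,
    matchingGenPoly_image_map, matchingGenPoly_image_map]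
  congr 4
  ext e
  have h1 : ∀ x : V ⊕ Fin s, x ∈ Finset.univ.map Function.Embedding.inr →
      x ∉ e.map Function.Embedding.inl := by
    rintro (x | x) <;> simp
  rw [Finset.disjoint_insert_left]
  simp only [Finset.disjoint_left.2 fun x => h1 x, and_true]
  simp

theorem filter_addPendent {E : Finset (Finset V)} {v w : V} (h : w ≠ v) :
    (addPendent s E v).filter (Sum.inl w ∉ ·) = addPendent s (E.filter (w ∉ ·)) v := by
  rw [addPendent, Finset.filter_insert, if_pos (by simp [h]), addPendent, Finset.filter_image]
  congr 3
  ext e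
  simp

end Pendent

theorem filter_image_loosePathEdgeNat {r t a b k : ℕ} (hb : b ≤ t) (hk : k < t + 1) :
    ((Finset.Ico a b).image (loosePathEdgeNat r t)).filter (Sum.inl ⟨k, hk⟩ ∉ ·) =
      ((Finset.Ico a b).filter (fun i => k ≠ i ∧ k ≠ i + 1)).image (loosePathEdgeNat r t) := by
  rw [Finset.filter_image]
  congr 1
  refine Finset.filter_congr fun i hi => ?_
  rw [inl_mem_loosePathEdgeNat (by simp only [Finset.mem_Ico] at hi; omega)]
  simp

/-- For `b ≥ 2`, `X p_{b-1} + X ^ 2 p_{b-2} = X p_b` and `p_{b+2} = p_b + X p_{b-1} + X p_b`. -/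
theorem pathGenPoly_relation (b : ℕ) (hb : 1 ≤ b) :
    pathGenPoly (b + 2) + 2 * X * pathGenPoly b + X ^ 2 * pathGenPoly (b - 2) =
      (1 + 4 * X) * pathGenPoly b := by
  match b, hb with
  -- The truncated index is harmless: running the recursion backwards gives `p_{-1} = 1 = p_0`.
  | 1, _ => rw [show 1 - 2 = 0 from rfl]; simp only [pathGenPoly]; ring
  | b + 2, _ =>
    rw [Nat.add_sub_cancel]
    simp only [pathGenPoly]
    ring

theorem matchingGenPoly_hyperW {r : ℕ} (hr : 2 ≤ r) {k : ℕ} (hk : 5 ≤ k) :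
    matchingGenPoly (hyperW r hr k).edges = (1 + 4 * X) * pathGenPoly (k - 4) := by
  obtain ⟨b, hb, hb1⟩ : ∃ b, b = k - 4 ∧ 1 ≤ b := ⟨_, rfl, by omega⟩
  have key : matchingGenPoly (hyperQ r hr 1 b 1).edges = (1 + 4 * X) * pathGenPoly b := by
    change matchingGenPoly (addPendent (r - 1) (addPendent (r - 1)
      (loosePath r hr (1 + b + 1)).edges (Sum.inl ⟨1, by omega⟩))
      (Sum.inl (Sum.inl ⟨1 + b, by omega⟩))) = _
    rw [matchingGenPoly_addPendent (by omega), filter_addPendent (by simp; omega),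
      matchingGenPoly_addPendent (by omega), matchingGenPoly_addPendent (by omega),
      loosePath_edges]
    have e1 : (Finset.Ico 0 (0 + (1 + b + 1))).filter (fun i => 1 ≠ i ∧ 1 ≠ i + 1) =
        Finset.Ico 2 (2 + b) := by
      ext i; simp only [Finset.mem_filter, Finset.mem_Ico]; omega
    have e2 : (Finset.Ico 0 (0 + (1 + b + 1))).filter (fun i => 1 + b ≠ i ∧ 1 + b ≠ i + 1) =
        Finset.Ico 0 (0 + b) := by
      ext i; simp only [Finset.mem_filter, Finset.mem_Ico]; omega
    -- Deleting both branching vertices leaves the `b - 2` edges strictly between them; for `b = 1`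
    -- both sides are empty.
    have e3 : (Finset.Ico 0 (0 + b)).filter (fun i => 1 ≠ i ∧ 1 ≠ i + 1) =
        Finset.Ico 2 (2 + (b - 2)) := by
      ext i; simp only [Finset.mem_filter, Finset.mem_Ico]; omega
    rw [filter_image_loosePathEdgeNat (by omega), filter_image_loosePathEdgeNat (by omega),
      e1, e2, filter_image_loosePathEdgeNat (by omega), e3,
      matchingGenPoly_image_loosePathEdgeNat _ _ (by omega),
      matchingGenPoly_image_loosePathEdgeNat _ _ (by omega),
      matchingGenPoly_image_loosePathEdgeNat _ _ (by omega),
      matchingGenPoly_image_loosePathEdgeNat _ _ (by omega), ← pathGenPoly_relation b hb1,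
      show 1 + b + 1 = b + 2 by ring]
    ring
  rw [hb] at key
  exact key

theorem matchingGenPoly_pathUnionW {r : ℕ} (hr : 2 ≤ r) (t : ℕ) {k : ℕ} (hk : 5 ≤ k) :
    matchingGenPoly (pathUnionW r hr t k).edges =
      (1 + 4 * X) * (pathGenPoly t * pathGenPoly (k - 4)) := by
  have hdis : ∀ e ∈ (loosePath r hr t).edges.image (fun e => e.map Function.Embedding.inl),
      ∀ f ∈ (hyperW r hr k).edges.image (fun e => e.map Function.Embedding.inr),
        Disjoint e f := by
    simp only [Finset.mem_image]
    rintro _ ⟨e, -, rfl⟩ _ ⟨f, -, rfl⟩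
    rw [Finset.disjoint_left]
    rintro (x | x) <;> simp
  change matchingGenPoly (_ ∪ _) = _
  rw [matchingGenPoly_union _ hdis, matchingGenPoly_image_map, matchingGenPoly_image_map,
    matchingGenPoly_hyperW hr hk, loosePath_edges,
    matchingGenPoly_image_loosePathEdgeNat _ _ (by omega)]
  · ring
  · exact disjoint_image_map_inl_inr (by omega) _ _

/-! ### From generating polynomials to matching energy -/

section MatchingPolynomial

variable {r : ℕ} {V W : Type} [DecidableEq V] [DecidableEq W]

theorem coeff_matchingGenPoly (H : UniformHypergraph r V) (k : ℕ) :
    (matchingGenPoly H.edges).coeff k = H.matchingCount k := by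
  rw [matchingGenPoly, finsetSum_coeff, matchingCount]
  simp only [coeff_X_pow]
  rw [Finset.sum_boole, Finset.filter_filter, Nat.cast_inj]
  congr 1
  ext M
  simp only [Finset.mem_filter, Finset.mem_powerset, Finset.mem_powersetCard]
  tauto

/-- The summation range may be enlarged, so two hypergraphs can be compared over a common range
without first comparing their numbers of edges. -/
theorem matchingPolynomial_eq_sum_range [Fintype V] (H : UniformHypergraph r V) {N : ℕ}
    (hN : H.edges.card + 1 ≤ N) :
    H.matchingPolynomial = ∑ k ∈ Finset.range N,
      monomial (Fintype.card V - k * r) ((-1) ^ k * (matchingGenPoly H.edges).coeff k) := by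
  simp only [coeff_matchingGenPoly]
  refine Finset.sum_subset (Finset.range_mono hN) fun k _ hk => ?_
  have : H.edges.powersetCard k = ∅ :=
    Finset.powersetCard_eq_empty.2 (by simp only [Finset.mem_range] at hk; omega)
  simp [matchingCount, this]

theorem matchingEnergy_congr [Fintype V] [Fintype W] {G : UniformHypergraph r V}
    {H : UniformHypergraph r W} (hcard : Fintype.card V = Fintype.card W)
    (h : matchingGenPoly G.edges = matchingGenPoly H.edges) :
    G.matchingEnergy = H.matchingEnergy := by
  rw [matchingEnergy, matchingEnergy,
    G.matchingPolynomial_eq_sum_range (le_max_left _ (H.edges.card + 1)),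
    H.matchingPolynomial_eq_sum_range (le_max_right (G.edges.card + 1) _), hcard, h]

end MatchingPolynomial

theorem matchingEnergy_pathUnionW {m n r : ℕ} (hm : 6 ≤ m) (hn : 6 ≤ n) (hr : 2 ≤ r) :
    (pathUnionW r hr (m - 5) (n - 1)).matchingEnergy =
      (pathUnionW r hr (n - 5) (m - 1)).matchingEnergy := by
  obtain ⟨a, rfl⟩ := Nat.exists_eq_add_of_le hm
  obtain ⟨b, rfl⟩ := Nat.exists_eq_add_of_le hn
  apply matchingEnergy_congr
  -- The number of vertices depends on `t` and `k - 4` only through their sum.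
  · simp only [Fintype.card_sum, Fintype.card_prod, Fintype.card_fin]
    rw [show 6 + a - 5 = a + 1 by omega, show 6 + b - 5 = b + 1 by omega,
      show 6 + a - 1 - 4 = a + 1 by omega, show 6 + b - 1 - 4 = b + 1 by omega]
    ring
  · rw [matchingGenPoly_pathUnionW hr _ (by omega), matchingGenPoly_pathUnionW hr _ (by omega),
      show 6 + b - 1 - 4 = 6 + b - 5 by omega, show 6 + a - 1 - 4 = 6 + a - 5 by omega]
    ring

end UniformHypergraph

theorem theorem5p2 (m n r : ℕ) (hm : 6 ≤ m) (hn : 6 ≤ n) (hr : 3 ≤ r) :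
    -- the maxima that define the two spectral radii are attained
    IsGreatest (UniformHypergraph.pathUnionW r (Nat.le_of_succ_le hr) (m - 5) (n - 1)).adjacencyTensor.eigenvalueModuli
      (UniformHypergraph.pathUnionW r (Nat.le_of_succ_le hr) (m - 5) (n - 1)).spectralRadius ∧
    IsGreatest (UniformHypergraph.pathUnionW r (Nat.le_of_succ_le hr) (n - 5) (m - 1)).adjacencyTensor.eigenvalueModuli
      (UniformHypergraph.pathUnionW r (Nat.le_of_succ_le hr) (n - 5) (m - 1)).spectralRadius ∧
    -- the spectral radii agree, and so do the matching energies
    (UniformHypergraph.pathUnionW r (Nat.le_of_succ_le hr) (m - 5) (n - 1)).spectralRadius =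
      (UniformHypergraph.pathUnionW r (Nat.le_of_succ_le hr) (n - 5) (m - 1)).spectralRadius ∧
    (UniformHypergraph.pathUnionW r (Nat.le_of_succ_le hr) (m - 5) (n - 1)).matchingEnergy =
      (UniformHypergraph.pathUnionW r (Nat.le_of_succ_le hr) (n - 5) (m - 1)).matchingEnergy := by
  have h2 : 2 ≤ r := Nat.le_of_succ_le hr
  -- With `c = 2 ^ (-1 / r)` the common spectral radius `(c ^ 2)⁻¹` is `4 ^ (1 / r)`.
  obtain ⟨c, hc, hcr⟩ : ∃ c : ℝ, 0 < c ∧ c ^ r = 1 / 2 :=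
    ⟨(1 / 2 : ℝ) ^ ((r : ℝ)⁻¹), Real.rpow_pos_of_pos (by norm_num) _,
      Real.rpow_inv_natCast_pow (by norm_num) (by omega)⟩
  have h₁ := UniformHypergraph.isGreatest_eigenvalueModuli_pathUnionW h2 hc hcr (m - 5)
    (k := n - 1) (by omega)
  have h₂ := UniformHypergraph.isGreatest_eigenvalueModuli_pathUnionW h2 hc hcr (n - 5)
    (k := m - 1) (by omega)
  have e₁ : (UniformHypergraph.pathUnionW r h2 (m - 5) (n - 1)).spectralRadius = (c ^ 2)⁻¹ :=
    h₁.csSup_eq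
  have e₂ : (UniformHypergraph.pathUnionW r h2 (n - 5) (m - 1)).spectralRadius = (c ^ 2)⁻¹ :=
    h₂.csSup_eq
  exact ⟨e₁ ▸ h₁, e₂ ▸ h₂, e₁.trans e₂.symm,
    UniformHypergraph.matchingEnergy_pathUnionW hm hn h2⟩
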